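/- Let $T$ be a Bienaymé–Galton–Watson tree with root $\rho$ and offspring distribution $L$, where $\mathbb E[L]=m\in[1,\infty)$ and $\mathbb E[L\log_+L]<\infty$. Independently of $T$, attach i.i.d. Uniform$(0,1)$ random variables $U_v$ to its vertices, and for $\theta\in[0,1]$ put $X_v=U_v+\theta\,d(\rho,v)$, where $d$ is the graph distance (the Rough Mount Fuji model). Then for every $\theta\in[0,1]$ with $\theta>1-\sqrt{1-1/m}$, $$\mathbb P(\text{there is an infinite path in } T \text{ started from } \rho \text{ along which the labels } X_v \text{ are strictly increasing})>0 .$$ In particular, $$\theta_c(m)\le 1-\sqrt{1-\tfrac1m},\qquad\text{where } 1-\sqrt{1-\tfrac1m}\sim\tfrac1{2m}\ \text{ as } m\to\infty .$$ Here the bound holds for $\theta_c(m)$ in both of the following senses: 1. the critical parameter of the model on $T$, i.e. the supremum of the $\theta\in[0,1]$ for which the probability above is zero; 2. the value $\theta_c(m)\in(0,1]$ defined implicitly by $m_c(\theta_c(m))=m$, where for $\theta\in(0,1]$ one writes $m_c(\theta)$ for the minimal real root of $$Q_\theta(x)=\sum_{j=0}^{\lfloor 1/\theta\rfloor+1}\frac{(-x)^j}{j!}\bigl(1-(j-1)\theta\bigr)^j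 ;$$ that is, every $t\in(0,1]$ with $m_c(t)=m$ satisfies $t\le 1-\sqrt{1-1/m}$. -/

import Mathlib

open MeasureTheory ProbabilityTheory Filter Asymptotics
open scoped Nat

/-- The rooted tree with offspring numbers `N`, in Ulam-Harris notation: vertices are finite words
of natural numbers, the root is the empty word, and the children of `w` are the words `w ++ [i]`
with `i < N w`. -/
def offspringTree (N : List ℕ → ℕ) : Set (List ℕ) :=
  {v | ∀ (w : List ℕ) (i : ℕ), w ++ [i] <+: v → i < N w}

/-- The Rough Mount Fuji label `X_v = U_v + θ d(ρ, v)`; in a tree of words, the graph distance from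
the root to `v` is the length of `v`. -/
def rmfLabel (U : List ℕ → ℝ) (θ : ℝ) (v : List ℕ) : ℝ :=
  U v + θ * (v.length : ℝ)

/-- Accessibility percolation: there is an infinite path in the tree, started at the root, along
which the labels are strictly increasing. (An infinite simple path from the root of a tree moves
from a vertex to one of its children at each step.) -/
def AccessibilityPercolation (N : List ℕ → ℕ) (U : List ℕ → ℝ) (θ : ℝ) : Prop :=
  ∃ p : ℕ → List ℕ, p 0 = [] ∧ (∀ n, p n ∈ offspringTree N) ∧
    (∀ n, ∃ i : ℕ, p (n + 1) = p n ++ [i]) ∧ StrictMono fun n => rmfLabel U θ (p n)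

/-- The random variables `N v` and `U v` realise a Bienaymé-Galton-Watson tree with offspring
distribution `ν` and, independently of it, i.i.d. Uniform(0,1) variables at the vertices. -/
structure IsBGWWithUniforms {Ω : Type*} [MeasurableSpace Ω] (P : Measure Ω) (ν : Measure ℕ)
    (N : List ℕ → Ω → ℕ) (U : List ℕ → Ω → ℝ) : Prop where
  measurable_offspring : ∀ v, Measurable (N v)
  measurable_uniform : ∀ v, Measurable (U v)
  law_offspring : ∀ v, P.map (N v) = ν
  law_uniform : ∀ v, P.map (U v) = volume.restrict (Set.Ioo (0 : ℝ) 1)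
  indep_offspring : iIndepFun N P
  indep_uniform : iIndepFun U P
  indep_offspring_uniform : IndepFun (fun ω v => N v ω) (fun ω v => U v ω) P

/-- The event of accessibility percolation with parameter `θ`. -/
def percolationEvent {Ω : Type*} (N : List ℕ → Ω → ℕ) (U : List ℕ → Ω → ℝ) (θ : ℝ) : Set Ω :=
  {ω | AccessibilityPercolation (fun v => N v ω) (fun v => U v ω) θ}

/-- The critical parameter of the percolation model: the supremum of the `θ ∈ [0,1]` for which
accessibility percolation has probability zero. -/
noncomputable def criticalTheta {Ω : Type*} [MeasurableSpace Ω] (P : Measure Ω)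
    (N : List ℕ → Ω → ℕ) (U : List ℕ → Ω → ℝ) : ℝ :=
  sSup {θ : ℝ | 0 ≤ θ ∧ θ ≤ 1 ∧ P (percolationEvent N U θ) = 0}

/-- `Q_θ(x) = ∑_{j=0}^{⌊1/θ⌋+1} (-x)^j / j! * (1 - (j-1)θ)^j`. -/
noncomputable def criticalPoly (θ x : ℝ) : ℝ :=
  ∑ j ∈ Finset.range (⌊1 / θ⌋₊ + 2), (-x) ^ j / (j ! : ℝ) * (1 - ((j : ℝ) - 1) * θ) ^ j

/-- `m = m_c(θ)`: `m` is the minimal root of `Q_θ`. -/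
def IsCriticalMean (θ m : ℝ) : Prop :=
  IsLeast {x : ℝ | criticalPoly θ x = 0} m

/-!
The vertices that can be reached from the root along increasing labels form a multitype branching
process, the type of a vertex being its uniform variable: a child with variable `y` of a vertex with
variable `u` is reached exactly when `y > u - θ`. Its mean operator is
`m * ∫ y in max 0 (u - θ)..1, f y`. The function equal to `1` on `[0, θ]` and then decreasing to `0`
with slope `-1 / c`, where `c = θ * (2 - θ)`, is a subeigenfunction `f` with factor `m * c`, and
`m * c > 1` says `θ > 1 - √(1 - 1 / m)`. A small multiple of `f` then bounds from below, by
induction on `n`, the probability that `n` generations are reached, and König's lemma provides the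
infinite path.

For the second sense of `θ_c`, the solution `F` of the delay equation `F' s = -x * F (s - θ)` with
`F = 1` on `[0, θ]` satisfies `F (1 + θ) = Q_θ(x)`. If `Q_θ` had no root in `[0, x]` for
`x = 1 / c`, then `F` would be a positive strict supersolution,
`∫ y in max 0 (u - θ)..1, F y < c * F u`, which the subeigenfunction excludes by comparison. Hence
the minimal root of `Q_θ` is at most `1 / c`.
-/

/-- The mean operator of the model per unit of mean offspring: a vertex with uniform variable `u`
and `m` children has in expectation `m * meanOperator θ f u` accessible children, a child with
uniform variable `y` being counted with weight `f y` and being accessible when `y > u - θ`. -/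
noncomputable def meanOperator (θ : ℝ) (f : ℝ → ℝ) (u : ℝ) : ℝ :=
  ∫ y in max 0 (u - θ)..1, f y

/-- A normalised function `f` with `c * f ≤ meanOperator θ f` on `[0, 1]`. The existence of one with
`m * c > 1` is the supercriticality condition of the multitype branching process of accessible
vertices when the mean offspring is `m`. -/
structure IsSubeigenfunction (θ c : ℝ) (f : ℝ → ℝ) : Prop where
  continuous : Continuous f
  nonneg : ∀ u, 0 ≤ f u
  le_one : ∀ u, f u ≤ 1
  zero_pos : 0 < f 0
  mul_le_meanOperator : ∀ u ∈ Set.Icc (0 : ℝ) 1, c * f u ≤ meanOperator θ f u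

section MeanOperator

variable {θ c u : ℝ} {f g : ℝ → ℝ}

lemma max_zero_sub_mem_Icc (hθ : 0 ≤ θ) (hu : u ≤ 1) : max 0 (u - θ) ∈ Set.Icc (0 : ℝ) 1 :=
  ⟨le_max_left _ _, max_le zero_le_one (by linarith)⟩

lemma meanOperator_const_mul (r : ℝ) :
    meanOperator θ (fun y => r * f y) u = r * meanOperator θ f u :=
  intervalIntegral.integral_const_mul r f

lemma meanOperator_mono (hθ : 0 ≤ θ) (hf : Continuous f) (hg : Continuous g)
    (hfg : ∀ y ∈ Set.Icc (0 : ℝ) 1, f y ≤ g y) (hu : u ≤ 1) :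
    meanOperator θ f u ≤ meanOperator θ g u :=
  have hb := max_zero_sub_mem_Icc hθ hu
  intervalIntegral.integral_mono_on hb.2 (hf.intervalIntegrable _ _) (hg.intervalIntegrable _ _)
    fun y hy => hfg y ⟨hb.1.trans hy.1, hy.2⟩

lemma meanOperator_nonneg (hθ : 0 ≤ θ) (hf : ∀ y ∈ Set.Icc (0 : ℝ) 1, 0 ≤ f y) (hu : u ≤ 1) :
    0 ≤ meanOperator θ f u :=
  have hb := max_zero_sub_mem_Icc hθ hu
  intervalIntegral.integral_nonneg hb.2 fun y hy => hf y ⟨hb.1.trans hy.1, hy.2⟩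

lemma meanOperator_le_one (hθ : 0 ≤ θ) (hfc : Continuous f) (hf : ∀ y, f y ≤ 1) (hu : u ≤ 1) :
    meanOperator θ f u ≤ 1 := by
  have hmono := meanOperator_mono hθ hfc continuous_const (fun y _ => hf y) hu
  have hone : meanOperator θ (fun _ => 1) u = 1 - max 0 (u - θ) := by simp [meanOperator]
  linarith [le_max_left 0 (u - θ)]

lemma ofReal_meanOperator_eq_lintegral (hθ : 0 ≤ θ) (hfc : Continuous f) (hf : ∀ y, 0 ≤ f y)
    (hu : u ≤ 1) : ENNReal.ofReal (meanOperator θ f u)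
      = ∫⁻ y in Set.Ioo 0 1 ∩ Set.Ioi (u - θ), ENNReal.ofReal (f y) := by
  have hset : Set.Ioo (0 : ℝ) 1 ∩ Set.Ioi (u - θ) = Set.Ioo (max 0 (u - θ)) 1 := by
    rw [Set.inter_comm, ← Set.Ioi_inter_Iio, ← Set.inter_assoc, Set.Ioi_inter_Ioi, max_comm,
      Set.Ioi_inter_Iio]
  rw [hset, ← ofReal_integral_eq_lintegral_ofReal
      (hfc.integrableOn_Icc.mono_set Set.Ioo_subset_Icc_self) (.of_forall hf),
    ← integral_Ioc_eq_integral_Ioo,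
    ← intervalIntegral.integral_of_le (max_zero_sub_mem_Icc hθ hu).2, meanOperator]

/-- Comparison principle: look at a point where `f / F` is maximal. -/
lemma nonpos_of_subsolution_of_strict_supersolution (hθ : 0 ≤ θ) {F : ℝ → ℝ} (hf : Continuous f)
    (hF : Continuous F) (hFpos : ∀ u ∈ Set.Icc (0 : ℝ) 1, 0 < F u)
    (hsub : ∀ u ∈ Set.Icc (0 : ℝ) 1, c * f u ≤ meanOperator θ f u)
    (hsuper : ∀ u ∈ Set.Icc (0 : ℝ) 1, meanOperator θ F u < c * F u)
    (hu : u ∈ Set.Icc (0 : ℝ) 1) : f u ≤ 0 := by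
  obtain ⟨v, hv, hmax⟩ := isCompact_Icc.exists_isMaxOn (Set.nonempty_Icc.2 (zero_le_one' ℝ))
    (hf.continuousOn.div hF.continuousOn fun u hu => (hFpos u hu).ne')
  set r := f v / F v with hr
  have hle : ∀ y ∈ Set.Icc (0 : ℝ) 1, f y ≤ r * F y := fun y hy =>
    (div_le_iff₀ (hFpos y hy)).1 (hmax hy)
  have hr_nonpos : r ≤ 0 := by
    by_contra! hr_pos
    have : c * f v < c * f v := calc
      c * f v ≤ meanOperator θ f v := hsub v hv
      _ ≤ meanOperator θ (fun y => r * F y) v :=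
        meanOperator_mono hθ hf (hF.const_mul r) hle hv.2
      _ = r * meanOperator θ F v := meanOperator_const_mul r
      _ < r * (c * F v) := mul_lt_mul_of_pos_left (hsuper v hv) hr_pos
      _ = c * f v := by rw [mul_left_comm, hr, div_mul_cancel₀ _ (hFpos v hv).ne']
    exact this.false
  exact (hle u hu).trans (mul_nonpos_of_nonpos_of_nonneg hr_nonpos (hFpos u hu).le)

end MeanOperator

/-- The function equal to `1` up to `θ` and then decreasing to `0` with slope `-1 / c`. -/
noncomputable def ramp (θ c u : ℝ) : ℝ :=
  max 0 (1 - max 0 (u - θ) / c)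

section Ramp

variable {θ c u : ℝ}

lemma continuous_ramp (θ c : ℝ) : Continuous (ramp θ c) := by
  unfold ramp
  fun_prop

lemma ramp_nonneg (θ c u : ℝ) : 0 ≤ ramp θ c u := le_max_left _ _

lemma ramp_le_one (hc : 0 ≤ c) (u : ℝ) : ramp θ c u ≤ 1 :=
  max_le zero_le_one (sub_le_self _ (by positivity))

lemma ramp_of_le (hu : u ≤ θ) : ramp θ c u = 1 := by
  simp [ramp, max_eq_left (sub_nonpos.2 hu)]

lemma one_sub_div_le_ramp (hu : θ ≤ u) : 1 - (u - θ) / c ≤ ramp θ c u := by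
  rw [ramp, max_eq_right (sub_nonneg.2 hu)]
  exact le_max_right _ _

lemma sub_sq_div_le_integral_ramp {b s : ℝ} (hs : 0 ≤ s) (hsb : θ + s ≤ b) :
    s - s ^ 2 / (2 * c) ≤ ∫ u in θ..b, ramp θ c u := by
  have hint (a b : ℝ) : IntervalIntegrable (ramp θ c) volume a b :=
    (continuous_ramp θ c).intervalIntegrable a b
  calc s - s ^ 2 / (2 * c) = ∫ u in θ..θ + s, (1 - (u - θ) / c) := by
        rw [intervalIntegral.integral_comp_sub_right (fun v => 1 - v / c),
          intervalIntegral.integral_sub (by simp) (Continuous.intervalIntegrable (by fun_prop) _ _)]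
        simp [div_div]
    _ ≤ ∫ u in θ..θ + s, ramp θ c u :=
        intervalIntegral.integral_mono_on (by linarith)
          (Continuous.intervalIntegrable (by fun_prop) _ _) (hint _ _)
          fun u hu => one_sub_div_le_ramp hu.1
    _ ≤ (∫ u in θ..θ + s, ramp θ c u) + ∫ u in θ + s..b, ramp θ c u :=
        le_add_of_nonneg_right
          (intervalIntegral.integral_nonneg hsb fun u _ => ramp_nonneg θ c u)
    _ = ∫ u in θ..b, ramp θ c u :=
        intervalIntegral.integral_add_adjacent_intervals (hint _ _) (hint _ _)

lemma integral_ramp_eq_add (hθ : 0 ≤ θ) (b : ℝ) :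
    ∫ u in (0 : ℝ)..b, ramp θ c u = θ + ∫ u in θ..b, ramp θ c u := by
  have hone : ∫ u in (0 : ℝ)..θ, ramp θ c u = θ := by
    rw [intervalIntegral.integral_congr (g := fun _ => 1)]
    · simp
    · intro u hu
      rw [Set.uIcc_of_le hθ] at hu
      exact ramp_of_le hu.2
  rw [← intervalIntegral.integral_add_adjacent_intervals (b := θ)
    ((continuous_ramp θ c).intervalIntegrable _ _)
    ((continuous_ramp θ c).intervalIntegrable _ _), hone]

lemma le_integral_ramp (h0 : 0 < θ) (h1 : θ ≤ 1) :
    θ * (2 - θ) ≤ ∫ u in (0 : ℝ)..1, ramp θ (θ * (2 - θ)) u := by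
  have hc : 0 < θ * (2 - θ) := mul_pos h0 (by linarith)
  rw [integral_ramp_eq_add h0.le]
  rcases le_total (θ + θ * (2 - θ)) 1 with h | h
  · have hlow := sub_sq_div_le_integral_ramp (c := θ * (2 - θ)) hc.le h
    have harea : (θ * (2 - θ)) ^ 2 / (2 * (θ * (2 - θ))) = θ * (2 - θ) / 2 := by field_simp
    nlinarith
  · have hlow := sub_sq_div_le_integral_ramp (θ := θ) (b := 1) (s := 1 - θ) (c := θ * (2 - θ))
      (by linarith) (by linarith)
    have harea : (1 - θ) ^ 2 / (2 * (θ * (2 - θ))) ≤ (1 - θ) ^ 2 :=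
      div_le_self (sq_nonneg _) (by nlinarith)
    nlinarith

/-- Since `ramp ≤ 1`, integrating it over `[0, b]` costs at most `b`, so that integrating it over
`[(u - θ)⁺, 1]` leaves at least `c - (u - θ)⁺`, whose positive part is `c * ramp`. -/
lemma mul_ramp_le_meanOperator (hθ : 0 ≤ θ) (hc : 0 < c)
    (hint : c ≤ ∫ u in (0 : ℝ)..1, ramp θ c u) (hu : u ≤ 1) :
    c * ramp θ c u ≤ meanOperator θ (ramp θ c) u := by
  rw [ramp, mul_max_of_nonneg _ _ hc.le, mul_zero, mul_sub, mul_one, mul_div_cancel₀ _ hc.ne']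
  refine max_le (meanOperator_nonneg hθ (fun y _ => ramp_nonneg θ c y) hu) ?_
  rw [meanOperator]
  have hb : 0 ≤ max 0 (u - θ) := le_max_left _ _
  generalize max 0 (u - θ) = b at hb ⊢
  have hint' (a b : ℝ) : IntervalIntegrable (ramp θ c) volume a b :=
    (continuous_ramp θ c).intervalIntegrable a b
  have hhead : ∫ y in (0 : ℝ)..b, ramp θ c y ≤ b := by
    simpa using intervalIntegral.integral_mono_on hb (hint' 0 b)
      (intervalIntegrable_const (c := (1 : ℝ))) fun y _ => ramp_le_one hc.le y
  have hsplit := intervalIntegral.integral_add_adjacent_intervals (hint' 0 b) (hint' b 1)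
  linarith

lemma isSubeigenfunction_ramp (h0 : 0 < θ) (h1 : θ ≤ 1) :
    IsSubeigenfunction θ (θ * (2 - θ)) (ramp θ (θ * (2 - θ))) where
  continuous := continuous_ramp _ _
  nonneg := ramp_nonneg _ _
  le_one := ramp_le_one (mul_nonneg h0.le (by linarith))
  zero_pos := by simp [ramp_of_le h0.le]
  mul_le_meanOperator _ hu :=
    mul_ramp_le_meanOperator h0.le (mul_pos h0 (by linarith)) (le_integral_ramp h0 h1) hu.2

end Ramp

/-- The solution `F` of the delay equation `F' s = -x * F (s - θ)` with `F = 1` on `[0, θ]`, as a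
delayed exponential series. The truncation only loses terms that vanish for `s ≤ 1 + θ`, the only
range in which it is used. -/
noncomputable def delayExp (θ x s : ℝ) : ℝ :=
  ∑ j ∈ Finset.range (⌊1 / θ⌋₊ + 2), (-x) ^ j / (j ! : ℝ) * max 0 (s - j * θ) ^ j

section DelayExp

variable {θ x s : ℝ}

lemma continuous_uncurry_delayExp (θ : ℝ) : Continuous (Function.uncurry (delayExp θ)) := by
  simp only [Function.uncurry_def, delayExp]
  fun_prop

lemma delayExp_zero (θ s : ℝ) : delayExp θ 0 s = 1 := by
  simp [delayExp, Finset.sum_range_succ']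

lemma delayExp_of_le (hθ : 0 < θ) (x : ℝ) (hs : s ≤ θ) : delayExp θ x s = 1 := by
  have hvanish (j : ℕ) : max 0 (s - (j + 1 : ℕ) * θ) = 0 :=
    max_eq_left (by push_cast; nlinarith [mul_nonneg j.cast_nonneg hθ.le])
  rw [delayExp, Finset.sum_range_succ', Finset.sum_eq_zero]
  · simp
  · intro j _
    rw [hvanish, zero_pow j.succ_ne_zero, mul_zero]

lemma criticalPoly_eq_delayExp (hθ : 0 < θ) (x : ℝ) :
    criticalPoly θ x = delayExp θ x (1 + θ) := by
  refine Finset.sum_congr rfl fun j hj => ?_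
  have hj : (j : ℝ) ≤ ⌊1 / θ⌋₊ + 1 := by
    exact_mod_cast Nat.lt_succ_iff.1 (Finset.mem_range.1 hj)
  have hfloor : (⌊1 / θ⌋₊ : ℝ) * θ ≤ 1 := (le_div_iff₀ hθ).1 (Nat.floor_le (by positivity))
  rw [max_eq_right (by nlinarith : 0 ≤ 1 + θ - j * θ)]
  ring

lemma hasDerivAt_max_zero_pow_succ {t : ℝ} (ht : t ≠ 0) {j : ℕ} (h : j ≠ 0 ∨ 0 < t) :
    HasDerivAt (fun s => max 0 s ^ (j + 1)) ((j + 1) * max 0 t ^ j) t := by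
  rcases ht.lt_or_gt with hneg | hpos
  · rw [max_eq_left hneg.le, zero_pow (h.resolve_right hneg.not_gt), mul_zero]
    refine (hasDerivAt_const t (0 : ℝ)).congr_of_eventuallyEq ?_
    filter_upwards [Iio_mem_nhds hneg] with s hs
    rw [max_eq_left (Set.mem_Iio.1 hs).le, zero_pow j.succ_ne_zero]
  · rw [max_eq_right hpos.le]
    refine (by simpa using hasDerivAt_pow (j + 1) t :
      HasDerivAt (· ^ (j + 1)) ((j + 1) * t ^ j) t).congr_of_eventuallyEq ?_
    filter_upwards [Ioi_mem_nhds hpos] with s hs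
    rw [max_eq_right (Set.mem_Ioi.1 hs).le]

lemma hasDerivAt_delayExp_add (hθ : 0 < θ) (x : ℝ) (hs : s ∈ Set.Ioo 0 1)
    (hsθ : ∀ j : ℕ, s ≠ j * θ) :
    HasDerivAt (fun s => delayExp θ x (s + θ)) (-x * delayExp θ x s) s := by
  have hterm (j : ℕ) : HasDerivAt
      (fun s => (-x) ^ (j + 1) / ((j + 1)! : ℝ) * max 0 (s + θ - (j + 1 : ℕ) * θ) ^ (j + 1))
      (-x * ((-x) ^ j / (j ! : ℝ) * max 0 (s - j * θ) ^ j)) s := by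
    have hshift (s : ℝ) : s + θ - (j + 1 : ℕ) * θ = s - j * θ := by push_cast; ring
    have hj : j ≠ 0 ∨ 0 < s - j * θ := by
      rcases eq_or_ne j 0 with rfl | hj
      · exact .inr (by simpa using hs.1)
      · exact .inl hj
    simp only [hshift]
    have hpow := (hasDerivAt_max_zero_pow_succ (sub_ne_zero.2 (hsθ j)) hj).comp_sub_const s (j * θ)
    refine (hpow.const_mul ((-x) ^ (j + 1) / ((j + 1)! : ℝ))).congr_deriv ?_
    rw [Nat.factorial_succ]
    push_cast
    field_simp
    ring
  have hlast : max 0 (s - (⌊1 / θ⌋₊ + 1 : ℕ) * θ) = 0 := by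
    have : 1 ≤ (⌊1 / θ⌋₊ + 1 : ℕ) * θ := by
      rw [← div_le_iff₀ hθ]
      exact_mod_cast (Nat.lt_floor_add_one _).le
    exact max_eq_left (by linarith [hs.2])
  have hsum : delayExp θ x s
      = ∑ j ∈ Finset.range (⌊1 / θ⌋₊ + 1), (-x) ^ j / (j ! : ℝ) * max 0 (s - j * θ) ^ j := by
    rw [delayExp, Finset.sum_range_succ, hlast, zero_pow (Nat.succ_ne_zero _), mul_zero, add_zero]
  rw [hsum, Finset.mul_sum]
  simp only [delayExp, Finset.sum_range_succ' _ (⌊1 / θ⌋₊ + 1), pow_zero]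
  exact (HasDerivAt.fun_sum fun j _ => hterm j).add_const _

lemma mul_integral_delayExp (hθ : 0 < θ) (x : ℝ) {a : ℝ} (ha : a ∈ Set.Icc 0 1) :
    x * ∫ s in a..1, delayExp θ x s = delayExp θ x (a + θ) - criticalPoly θ x := by
  have hcont : Continuous (delayExp θ x) := (continuous_uncurry_delayExp θ).curry_right
  have hftc := integral_eq_of_hasDerivAt_off_countable_of_le (fun s => delayExp θ x (s + θ))
    (fun s => -x * delayExp θ x s) ha.2 (Set.countable_range fun j : ℕ => j * θ)
    (by fun_prop)
    (fun s hs => hasDerivAt_delayExp_add hθ x ⟨ha.1.trans_lt hs.1.1, hs.1.2⟩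
      fun j hj => hs.2 ⟨j, hj.symm⟩)
    (Continuous.intervalIntegrable (by fun_prop) _ _)
  rw [intervalIntegral.integral_const_mul] at hftc
  rw [criticalPoly_eq_delayExp hθ]
  linarith

lemma mul_meanOperator_delayExp (hθ : 0 < θ) (x : ℝ) {u : ℝ} (hu : u ≤ 1) :
    x * meanOperator θ (delayExp θ x) u = delayExp θ x u - criticalPoly θ x := by
  rw [meanOperator, mul_integral_delayExp hθ x (max_zero_sub_mem_Icc hθ.le hu)]
  congr 1
  rcases le_total u θ with h | h
  · rw [max_eq_left (by linarith), zero_add, delayExp_of_le hθ x le_rfl, delayExp_of_le hθ x h]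
  · rw [max_eq_right (by linarith), sub_add_cancel]

end DelayExp

lemma forall_pos_of_nonneg_imp_pos {α : Type*} [TopologicalSpace α] {K : Set α}
    (hK : IsCompact K) {F : ℝ → α → ℝ} (hF : Continuous (Function.uncurry F)) {a b : ℝ}
    (hab : a ≤ b) (ha : ∀ s ∈ K, 0 < F a s)
    (hpos : ∀ x ∈ Set.Icc a b, (∀ s ∈ K, 0 ≤ F x s) → ∀ s ∈ K, 0 < F x s) :
    ∀ s ∈ K, 0 < F b s := by
  rcases K.eq_empty_or_nonempty with rfl | hne
  · simp
  set μ : ℝ → ℝ := fun x => sInf (F x '' K)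
  have hμ (x : ℝ) : ∃ s ∈ K, μ x = F x s ∧ ∀ t ∈ K, F x s ≤ F x t :=
    hK.exists_sInf_image_eq_and_le hne hF.curry_right.continuousOn
  have hμ_pos {x : ℝ} (hx : ∀ s ∈ K, 0 < F x s) : 0 < μ x := by
    obtain ⟨s, hs, hμs, -⟩ := hμ x
    exact hμs ▸ hx s hs
  have hμ_le (x : ℝ) : ∀ t ∈ K, μ x ≤ F x t := by
    obtain ⟨s, -, hμs, hle⟩ := hμ x
    exact hμs ▸ hle
  suffices 0 < μ b from fun s hs => this.trans_le (hμ_le b s hs)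
  by_contra! hb
  obtain ⟨y, hy, hμy⟩ := intermediate_value_Icc' hab (hK.continuous_sInf hF).continuousOn
    (show (0 : ℝ) ∈ Set.Icc (μ b) (μ a) from ⟨hb, (hμ_pos ha).le⟩)
  exact (hμ_pos (hpos y hy fun s hs => hμy ▸ hμ_le y s hs)).ne' hμy

section CriticalPoly

variable {θ c x m : ℝ} {f : ℝ → ℝ}

lemma delayExp_pos (hθ : 0 < θ) (hx : 0 ≤ x) (hQ : ∀ y ∈ Set.Icc 0 x, 0 < criticalPoly θ y) :
    ∀ u ∈ Set.Icc (0 : ℝ) 1, 0 < delayExp θ x u := by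
  refine forall_pos_of_nonneg_imp_pos isCompact_Icc (continuous_uncurry_delayExp θ) hx
    (fun u _ => by rw [delayExp_zero]; exact one_pos) fun y hy hnonneg u hu => ?_
  have hmean := mul_nonneg hy.1 (meanOperator_nonneg hθ.le hnonneg hu.2)
  linarith [mul_meanOperator_delayExp hθ y hu.2, hQ y hy]

/-- Otherwise `delayExp θ (1 / c)` would be a positive strict supersolution. -/
lemma IsSubeigenfunction.exists_criticalPoly_root (hf : IsSubeigenfunction θ c f) (hθ : 0 < θ)
    (hc : 0 < c) : ∃ x ≤ 1 / c, criticalPoly θ x = 0 := by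
  by_contra! hroot
  have hcontQ : Continuous (criticalPoly θ) := by
    unfold criticalPoly
    fun_prop
  have hQ : ∀ x ∈ Set.Icc 0 (1 / c), 0 < criticalPoly θ x := by
    intro x hx
    by_contra! hneg
    have hQ0 : criticalPoly θ 0 = 1 := by rw [criticalPoly_eq_delayExp hθ, delayExp_zero]
    obtain ⟨y, hy, hy0⟩ := intermediate_value_Icc' hx.1 hcontQ.continuousOn
      ⟨hneg, hQ0.symm ▸ zero_le_one⟩
    exact hroot y (hy.2.trans hx.2) hy0
  have hX : 0 ≤ 1 / c := by positivity
  have hsuper : ∀ u ∈ Set.Icc (0 : ℝ) 1,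
      meanOperator θ (delayExp θ (1 / c)) u < c * delayExp θ (1 / c) u := by
    intro u hu
    have hmean := mul_meanOperator_delayExp hθ (1 / c) hu.2
    rw [one_div_mul_eq_div, div_eq_iff hc.ne'] at hmean
    linarith [mul_pos (hQ (1 / c) ⟨hX, le_rfl⟩) hc]
  exact hf.zero_pos.not_ge <| nonpos_of_subsolution_of_strict_supersolution hθ.le hf.continuous
    (continuous_uncurry_delayExp θ).curry_right (delayExp_pos hθ hX hQ) hf.mul_le_meanOperator
    hsuper (Set.left_mem_Icc.2 zero_le_one)

lemma IsCriticalMean.mul_le_one (hm : IsCriticalMean θ m) (hθ : 0 < θ) (hθ' : θ ≤ 1) :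
    m * (θ * (2 - θ)) ≤ 1 := by
  have hc : 0 < θ * (2 - θ) := mul_pos hθ (by linarith)
  obtain ⟨x, hx, hroot⟩ := (isSubeigenfunction_ramp hθ hθ').exists_criticalPoly_root hθ hc
  exact (le_div_iff₀ hc).1 ((hm.2 hroot).trans hx)

end CriticalPoly

/-- Some path of `n` steps going down the tree from the vertex `w` has increasing labels. -/
def HasAccessiblePath (N : List ℕ → ℕ) (U : List ℕ → ℝ) (θ : ℝ) : ℕ → List ℕ → Prop
  | 0, _ => True
  | n + 1, w => ∃ i < N w, rmfLabel U θ w < rmfLabel U θ (w ++ [i]) ∧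
      HasAccessiblePath N U θ n (w ++ [i])

section HasAccessiblePath

variable {N : List ℕ → ℕ} {U : List ℕ → ℝ} {θ : ℝ} {w : List ℕ}

lemma nil_mem_offspringTree (N : List ℕ → ℕ) : [] ∈ offspringTree N :=
  fun w i h => absurd (List.prefix_nil.1 h) (List.append_ne_nil_of_right_ne_nil w (by simp))

lemma append_singleton_mem_offspringTree {i : ℕ} (hw : w ∈ offspringTree N) (hi : i < N w) :
    w ++ [i] ∈ offspringTree N := by
  intro v j hv
  rcases List.prefix_concat_iff.1 hv with h | h
  · obtain ⟨rfl, hij⟩ := List.append_inj' h rfl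
    rw [List.singleton_inj] at hij
    exact hij ▸ hi
  · exact hw v j h

lemma rmfLabel_lt_rmfLabel_append_singleton_iff (i : ℕ) :
    rmfLabel U θ w < rmfLabel U θ (w ++ [i]) ↔ U w - θ < U (w ++ [i]) := by
  simp only [rmfLabel, List.length_append, List.length_singleton, Nat.cast_add, Nat.cast_one]
  constructor <;> intro h <;> linarith

lemma HasAccessiblePath.of_succ {n : ℕ} (h : HasAccessiblePath N U θ (n + 1) w) :
    HasAccessiblePath N U θ n w := by
  induction n generalizing w with
  | zero => trivial
  | succ n ih =>
    obtain ⟨i, hi, hlt, hn⟩ := h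
    exact ⟨i, hi, hlt, ih hn⟩

lemma HasAccessiblePath.mono {k n : ℕ} (hkn : k ≤ n) (h : HasAccessiblePath N U θ n w) :
    HasAccessiblePath N U θ k w :=
  antitone_nat_of_succ_le (f := fun n => HasAccessiblePath N U θ n w)
    (fun _ => HasAccessiblePath.of_succ) hkn h

lemma exists_child_forall_hasAccessiblePath (h : ∀ n, HasAccessiblePath N U θ n w) :
    ∃ i < N w, rmfLabel U θ w < rmfLabel U θ (w ++ [i]) ∧
      ∀ n, HasAccessiblePath N U θ n (w ++ [i]) := by
  by_contra! hfin
  choose! k hk using hfin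
  obtain ⟨i, hi, hlt, hpath⟩ := h ((Finset.range (N w)).sup k + 1)
  exact hk i hi hlt (hpath.mono (Finset.le_sup (Finset.mem_range.2 hi)))

/-- König's lemma for accessible paths. -/
lemma accessibilityPercolation_of_forall_hasAccessiblePath
    (h : ∀ n, HasAccessiblePath N U θ n []) : AccessibilityPercolation N U θ := by
  choose child hchild_lt hlabel hchild using
    fun v : {w : List ℕ // ∀ n, HasAccessiblePath N U θ n w} =>
      exists_child_forall_hasAccessiblePath v.2
  let next : {w : List ℕ // ∀ n, HasAccessiblePath N U θ n w} →
      {w : List ℕ // ∀ n, HasAccessiblePath N U θ n w} := fun v => ⟨v.1 ++ [child v], hchild v⟩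
  let p (n : ℕ) : {w : List ℕ // ∀ n, HasAccessiblePath N U θ n w} := next^[n] ⟨[], h⟩
  have hp (n : ℕ) : (p (n + 1)).1 = (p n).1 ++ [child (p n)] := by
    simp only [p, Function.iterate_succ_apply', next]
  refine ⟨fun n => (p n).1, rfl, fun n => ?_, fun n => ⟨child (p n), hp n⟩,
    strictMono_nat_of_lt_succ fun n => ?_⟩
  · induction n with
    | zero => exact nil_mem_offspringTree N
    | succ n ih =>
      simp only [hp n]
      exact append_singleton_mem_offspringTree ih (hchild_lt _)
  · simp only [hp n]
    exact hlabel _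

end HasAccessiblePath

section Independence

variable {Ω ι κ : Type*} {mΩ : MeasurableSpace Ω} {P : Measure Ω}

lemma iIndep_sup {m₁ m₂ : ι → MeasurableSpace Ω} (hle₁ : ∀ i, m₁ i ≤ mΩ) (hle₂ : ∀ i, m₂ i ≤ mΩ)
    (h₁ : iIndep m₁ P) (h₂ : iIndep m₂ P) (h₁₂ : Indep (⨆ i, m₁ i) (⨆ i, m₂ i) P) :
    iIndep (fun i => m₁ i ⊔ m₂ i) P := by
  have := h₁.isProbabilityMeasure
  let π (i : ι) : Set (Set Ω) :=
    {s | ∃ A B, MeasurableSet[m₁ i] A ∧ MeasurableSet[m₂ i] B ∧ A ∩ B = s}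
  have hgen (i : ι) : m₁ i ⊔ m₂ i = MeasurableSpace.generateFrom (π i) := by
    refine le_antisymm (sup_le (fun A hA => ?_) fun B hB => ?_)
      (MeasurableSpace.generateFrom_le ?_)
    · exact MeasurableSpace.measurableSet_generateFrom
        ⟨A, Set.univ, hA, MeasurableSet.univ, Set.inter_univ A⟩
    · exact MeasurableSpace.measurableSet_generateFrom
        ⟨Set.univ, B, MeasurableSet.univ, hB, Set.univ_inter B⟩
    · rintro _ ⟨A, B, hA, hB, rfl⟩
      exact MeasurableSet.inter (le_sup_left (b := m₂ i) A hA) (le_sup_right (a := m₁ i) B hB)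
  refine iIndepSets.iIndep (fun i => sup_le (hle₁ i) (hle₂ i)) π ?_ hgen ?_
  · rintro i _ ⟨A, B, hA, hB, rfl⟩ _ ⟨A', B', hA', hB', rfl⟩ -
    exact ⟨A ∩ A', B ∩ B', hA.inter hA', hB.inter hB', Set.inter_inter_inter_comm _ _ _ _⟩
  · rw [iIndepSets_iff]
    intro s f hf
    choose! A B hA hB hAB using hf
    have hmeasA : MeasurableSet[⨆ i, m₁ i] (⋂ i ∈ s, A i) :=
      s.measurableSet_biInter fun i hi => le_iSup m₁ i _ (hA i hi)
    have hmeasB : MeasurableSet[⨆ i, m₂ i] (⋂ i ∈ s, B i) :=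
      s.measurableSet_biInter fun i hi => le_iSup m₂ i _ (hB i hi)
    calc P (⋂ i ∈ s, f i) = P ((⋂ i ∈ s, A i) ∩ ⋂ i ∈ s, B i) := by
          rw [← Set.iInter₂_congr hAB]
          simp only [Set.iInter_inter_distrib]
      _ = (∏ i ∈ s, P (A i)) * ∏ i ∈ s, P (B i) := by
          rw [(Indep_iff _ _ _).1 h₁₂ _ _ hmeasA hmeasB, h₁.meas_biInter hA, h₂.meas_biInter hB]
      _ = ∏ i ∈ s, P (f i) := by
          rw [← Finset.prod_mul_distrib]
          refine Finset.prod_congr rfl fun i hi => ?_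
          rw [← hAB i hi, (Indep_iff _ _ _).1 h₁₂ _ _ (le_iSup m₁ i _ (hA i hi))
            (le_iSup m₂ i _ (hB i hi))]

lemma iIndep_biSup_of_pairwise_disjoint {m : ι → MeasurableSpace Ω} (hle : ∀ i, m i ≤ mΩ)
    (hm : iIndep m P) {S : κ → Set ι} (hS : Pairwise fun i j => Disjoint (S i) (S j)) :
    iIndep (fun k => ⨆ i ∈ S k, m i) P := by
  classical
  have := hm.isProbabilityMeasure
  rw [iIndep_iff]
  intro s A hA
  induction s using Finset.induction_on with
  | empty => simp
  | insert k s hk ih =>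
    have hdisj : Disjoint (S k) (⋃ j ∈ s, S j) := by
      rw [Set.disjoint_iUnion₂_right]
      exact fun j hj => hS (ne_of_mem_of_not_mem hj hk).symm
    have hmeas : MeasurableSet[⨆ i ∈ ⋃ j ∈ s, S j, m i] (⋂ j ∈ s, A j) :=
      s.measurableSet_biInter fun j hj =>
        biSup_mono (f := m) (fun _ hi => Set.mem_biUnion hj hi) _
          (hA j (Finset.mem_insert_of_mem hj))
    rw [Finset.set_biInter_insert, Finset.prod_insert hk,
      (Indep_iff _ _ _).1 (indep_iSup_of_disjoint hle hm hdisj) _ _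
        (hA k (Finset.mem_insert_self k s)) hmeas,
      ih fun j hj => hA j (Finset.mem_insert_of_mem hj)]

lemma one_sub_pow_le_measureReal_biUnion {A : ℕ → Set Ω} (hA : ∀ i, MeasurableSet (A i))
    (hind : iIndepSet A P) {z : ℝ} (hz : ∀ i, z ≤ P.real (A i)) (k : ℕ) :
    1 - (1 - z) ^ k ≤ P.real (⋃ i ∈ Finset.range k, A i) := by
  have := iIndep.isProbabilityMeasure hind
  have hcompl : P.real (⋂ i ∈ Finset.range k, (A i)ᶜ)
      = ∏ i ∈ Finset.range k, (1 - P.real (A i)) := by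
    rw [measureReal_def, iIndep.meas_biInter hind fun i _ =>
      (MeasurableSpace.measurableSet_generateFrom (Set.mem_singleton (A i))).compl,
      ENNReal.toReal_prod]
    exact Finset.prod_congr rfl fun i _ => probReal_compl_eq_one_sub (hA i)
  calc 1 - (1 - z) ^ k = 1 - ∏ i ∈ Finset.range k, (1 - z) := by
        rw [Finset.prod_const, Finset.card_range]
    _ ≤ 1 - ∏ i ∈ Finset.range k, (1 - P.real (A i)) :=
        sub_le_sub_left (Finset.prod_le_prod (fun i _ => sub_nonneg.2 measureReal_le_one)
          fun i _ => sub_le_sub_left (hz i) 1) 1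
    _ = P.real (⋃ i ∈ Finset.range k, A i) := by
        rw [← hcompl, ← probReal_compl_eq_one_sub
          (Finset.measurableSet_biInter _ fun i _ => (hA i).compl)]
        simp only [Set.compl_iInter, compl_compl]

lemma measure_preimage_prodMk_eq_lintegral [IsFiniteMeasure P] {α β : Type*} [MeasurableSpace α]
    [MeasurableSpace β] {X : Ω → α} {Y : Ω → β} (hX : Measurable X) (hY : Measurable Y)
    (hXY : IndepFun X Y P) {A : Set (α × β)} (hA : MeasurableSet A) :
    P {ω | (X ω, Y ω) ∈ A} = ∫⁻ x, P {ω | (x, Y ω) ∈ A} ∂P.map X := by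
  calc P {ω | (X ω, Y ω) ∈ A} = P.map (fun ω => (X ω, Y ω)) A :=
        (Measure.map_apply (hX.prodMk hY) hA).symm
    _ = ∫⁻ x, P.map Y (Prod.mk x ⁻¹' A) ∂P.map X := by
        rw [hXY.map_prod_eq_prod_map_map hX.aemeasurable hY.aemeasurable, Measure.prod_apply hA]
    _ = ∫⁻ x, P {ω | (x, Y ω) ∈ A} ∂P.map X :=
        lintegral_congr fun x => Measure.map_apply hY (measurable_prodMk_left hA)

end Independence

section Configuration

variable {Ω : Type*} {N : List ℕ → Ω → ℕ} {U : List ℕ → Ω → ℝ}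

/-- The σ-algebra generated by the offspring number and the uniform variable of the vertex `v`. -/
abbrev vertexSigma (N : List ℕ → Ω → ℕ) (U : List ℕ → Ω → ℝ) (v : List ℕ) : MeasurableSpace Ω :=
  MeasurableSpace.comap (N v) inferInstance ⊔ MeasurableSpace.comap (U v) inferInstance

/-- The σ-algebra generated by the offspring numbers and the uniform variables of the vertices
in `S`. -/
abbrev configSigma (N : List ℕ → Ω → ℕ) (U : List ℕ → Ω → ℝ) (S : Set (List ℕ)) :
    MeasurableSpace Ω :=
  ⨆ v ∈ S, vertexSigma N U v

/-- Some path of `n` steps going down from the vertex `w` has increasing labels, and the uniform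
variable of `w` exceeds `b`. -/
def survivalEvent (N : List ℕ → Ω → ℕ) (U : List ℕ → Ω → ℝ) (θ : ℝ) (n : ℕ) (w : List ℕ) (b : ℝ) :
    Set Ω :=
  {ω | b < U w ω ∧ HasAccessiblePath (fun v => N v ω) (fun v => U v ω) θ n w}

variable {S : Set (List ℕ)} {v : List ℕ}

lemma measurable_offspring_configSigma (hv : v ∈ S) : Measurable[configSigma N U S] (N v) :=
  measurable_iff_comap_le.2 (le_sup_left.trans (le_biSup (vertexSigma N U) hv))

lemma measurable_uniform_configSigma (hv : v ∈ S) : Measurable[configSigma N U S] (U v) :=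
  measurable_iff_comap_le.2 (le_sup_right.trans (le_biSup (vertexSigma N U) hv))

lemma measurableSet_hasAccessiblePath [MeasurableSpace Ω] (θ : ℝ) (n : ℕ) {w : List ℕ}
    (hN : ∀ v, w <+: v → Measurable (N v)) (hU : ∀ v, w <+: v → Measurable (U v)) :
    MeasurableSet {ω | HasAccessiblePath (fun v => N v ω) (fun v => U v ω) θ n w} := by
  induction n generalizing w with
  | zero => simp only [HasAccessiblePath, Set.ofPred_true, MeasurableSet.univ]
  | succ n ih =>
    simp only [HasAccessiblePath, rmfLabel_lt_rmfLabel_append_singleton_iff]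
    have hw := List.prefix_refl w
    refine measurableSet_setOfPred.2 <| Measurable.exists fun i => ?_
    have hi := List.prefix_append w [i]
    exact (measurableSet_setOfPred.1 (measurableSet_lt measurable_const (hN w hw))).and <|
      (measurableSet_setOfPred.1 (measurableSet_lt ((hU w hw).sub_const θ) (hU _ hi))).and <|
      measurableSet_setOfPred.1 (ih (fun v hv => hN v (hi.trans hv)) fun v hv => hU v (hi.trans hv))

lemma measurableSet_survivalEvent [MeasurableSpace Ω] (θ : ℝ) (n : ℕ) {w : List ℕ} (b : ℝ)
    (hN : ∀ v, w <+: v → Measurable (N v)) (hU : ∀ v, w <+: v → Measurable (U v)) :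
    MeasurableSet (survivalEvent N U θ n w b) :=
  (measurableSet_lt measurable_const (hU w (List.prefix_refl w))).inter
    (measurableSet_hasAccessiblePath θ n hN hU)

lemma measurable_children [MeasurableSpace Ω] (θ : ℝ) (n : ℕ) {w : List ℕ}
    (hN : ∀ i v, w ++ [i] <+: v → Measurable (N v))
    (hU : ∀ i v, w ++ [i] <+: v → Measurable (U v)) :
    Measurable fun ω i => (U (w ++ [i]) ω,
      HasAccessiblePath (fun v => N v ω) (fun v => U v ω) θ n (w ++ [i])) :=
  measurable_pi_lambda _ fun i => (hU i _ (List.prefix_refl _)).prodMk <|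
    measurableSet_setOfPred.1 (measurableSet_hasAccessiblePath θ n (hN i) (hU i))

lemma antitone_survivalEvent (N : List ℕ → Ω → ℕ) (U : List ℕ → Ω → ℝ) (θ : ℝ) (w : List ℕ)
    (b : ℝ) : Antitone fun n => survivalEvent N U θ n w b :=
  fun _ _ hkn _ hω => ⟨hω.1, hω.2.mono hkn⟩

lemma disjoint_subtrees (w : List ℕ) :
    Pairwise fun i j => Disjoint {v : List ℕ | w ++ [i] <+: v} {v | w ++ [j] <+: v} := by
  intro i j hij
  rw [Set.disjoint_left]
  intro v hi hj
  have := List.prefix_of_prefix_length_le hi hj (by simp)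
  exact hij (by simpa using this)

lemma disjoint_singleton_subtrees (w : List ℕ) :
    Disjoint {w} {v : List ℕ | ∃ i, w ++ [i] <+: v} := by
  rw [Set.disjoint_singleton_left]
  rintro ⟨i, hi⟩
  simpa using hi.length_le

end Configuration

section OffspringLaw

variable {ν : Measure ℕ} {c : ℝ}

/-- Divide `1 - (1 - z) ^ k` by `z` and let `z → 0`. -/
lemma exists_mul_le_integral_one_sub_pow (hint : Integrable (fun k : ℕ => (k : ℝ)) ν)
    (hc : c < ∫ k : ℕ, (k : ℝ) ∂ν) : ∃ δ ∈ Set.Ioc (0 : ℝ) 1,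
      ∀ z ∈ Set.Icc 0 δ, c * z ≤ ∫ k : ℕ, (1 - (1 - z) ^ k) ∂ν := by
  have hlim : Tendsto (fun z : ℝ => ∫ k : ℕ, ∑ j ∈ Finset.range k, (1 - z) ^ j ∂ν)
      (nhdsWithin 0 (Set.Ici 0)) (nhds (∫ k : ℕ, (k : ℝ) ∂ν)) := by
    refine tendsto_integral_filter_of_dominated_convergence (fun k : ℕ => (k : ℝ))
      (.of_forall fun z => .of_discrete) ?_ hint (.of_forall fun k => ?_)
    · filter_upwards [Icc_mem_nhdsGE (zero_lt_one' ℝ)] with z hz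
      refine .of_forall fun k => ?_
      have hterm (j : ℕ) : |(1 - z) ^ j| ≤ 1 := by
        rw [abs_pow]
        exact pow_le_one₀ (abs_nonneg _) (abs_le.2 ⟨by linarith [hz.2], by linarith [hz.1]⟩)
      calc ‖∑ j ∈ Finset.range k, (1 - z) ^ j‖ ≤ ∑ _j ∈ Finset.range k, (1 : ℝ) :=
            norm_sum_le_of_le _ fun j _ => hterm j
        _ = k := by simp
    · have hcont : Continuous fun z : ℝ => ∑ j ∈ Finset.range k, (1 - z) ^ j := by fun_prop
      simpa using (hcont.tendsto 0).mono_left nhdsWithin_le_nhds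
  obtain ⟨r, hr, hsub⟩ := mem_nhdsGE_iff_exists_Icc_subset.1 (hlim (lt_mem_nhds hc))
  refine ⟨min r 1, ⟨lt_min hr one_pos, min_le_right r 1⟩, fun z hz => ?_⟩
  have hgeom (k : ℕ) : 1 - (1 - z) ^ k = z * ∑ j ∈ Finset.range k, (1 - z) ^ j := by
    simpa using (mul_neg_geom_sum (1 - z) k).symm
  simp only [hgeom, integral_const_mul]
  rw [mul_comm]
  exact mul_le_mul_of_nonneg_left (le_of_lt (hsub ⟨hz.1, hz.2.trans (min_le_left r 1)⟩)) hz.1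

end OffspringLaw

namespace IsBGWWithUniforms

variable {Ω : Type*} [MeasurableSpace Ω] {P : Measure Ω} {ν : Measure ℕ}
  {N : List ℕ → Ω → ℕ} {U : List ℕ → Ω → ℝ} {θ : ℝ} {n : ℕ} {w : List ℕ}

lemma vertexSigma_le (h : IsBGWWithUniforms P ν N U) (v : List ℕ) :
    vertexSigma N U v ≤ ‹MeasurableSpace Ω› :=
  sup_le (h.measurable_offspring v).comap_le (h.measurable_uniform v).comap_le

lemma iIndep_vertexSigma (h : IsBGWWithUniforms P ν N U) : iIndep (vertexSigma N U) P := by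
  have hN : ⨆ v, MeasurableSpace.comap (N v) inferInstance
      ≤ MeasurableSpace.comap (fun ω v => N v ω) inferInstance :=
    iSup_le fun v => ((measurable_pi_apply v).comp (comap_measurable fun ω v => N v ω)).comap_le
  have hU : ⨆ v, MeasurableSpace.comap (U v) inferInstance
      ≤ MeasurableSpace.comap (fun ω v => U v ω) inferInstance :=
    iSup_le fun v => ((measurable_pi_apply v).comp (comap_measurable fun ω v => U v ω)).comap_le
  exact iIndep_sup (fun v => (h.measurable_offspring v).comap_le)
    (fun v => (h.measurable_uniform v).comap_le) ((iIndepFun_iff_iIndep _ _ _).1 h.indep_offspring)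
    ((iIndepFun_iff_iIndep _ _ _).1 h.indep_uniform)
    (indep_of_indep_of_le_left (indep_of_indep_of_le_right
      ((IndepFun_iff_Indep _ _ _).1 h.indep_offspring_uniform) hU) hN)

lemma indepFun_offspring_uniform (h : IsBGWWithUniforms P ν N U) (w : List ℕ) :
    IndepFun (N w) (U w) P :=
  h.indep_offspring_uniform.comp (measurable_pi_apply w) (measurable_pi_apply w)

lemma map_prodMk [IsFiniteMeasure P] (h : IsBGWWithUniforms P ν N U) (w : List ℕ) :
    P.map (fun ω => (N w ω, U w ω)) = ν.prod (volume.restrict (Set.Ioo (0 : ℝ) 1)) := by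
  rw [(h.indepFun_offspring_uniform w).map_prod_eq_prod_map_map
    (h.measurable_offspring w).aemeasurable (h.measurable_uniform w).aemeasurable,
    h.law_offspring, h.law_uniform]

lemma measurableSet_survivalEvent (h : IsBGWWithUniforms P ν N U) (θ : ℝ) (n : ℕ) (w : List ℕ)
    (b : ℝ) : MeasurableSet (survivalEvent N U θ n w b) :=
  _root_.measurableSet_survivalEvent θ n b (fun v _ => h.measurable_offspring v)
    fun v _ => h.measurable_uniform v

lemma iIndepSet_survivalEvent (h : IsBGWWithUniforms P ν N U) (θ : ℝ) (n : ℕ) (w : List ℕ)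
    (b : ℝ) : iIndepSet (fun i => survivalEvent N U θ n (w ++ [i]) b) P := by
  refine iIndep_of_iIndep_of_le (iIndep_biSup_of_pairwise_disjoint h.vertexSigma_le
    h.iIndep_vertexSigma (disjoint_subtrees w)) fun i => MeasurableSpace.generateFrom_le ?_
  rintro _ rfl
  exact @_root_.measurableSet_survivalEvent Ω N U (configSigma N U _) θ n _ b
    (fun v hv => measurable_offspring_configSigma hv) fun v hv => measurable_uniform_configSigma hv

lemma indepFun_children (h : IsBGWWithUniforms P ν N U) (θ : ℝ) (n : ℕ) (w : List ℕ) :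
    IndepFun (fun ω => (N w ω, U w ω)) (fun ω i => (U (w ++ [i]) ω,
      HasAccessiblePath (fun v => N v ω) (fun v => U v ω) θ n (w ++ [i]))) P := by
  have hX : Measurable[configSigma N U {w}] fun ω => (N w ω, U w ω) :=
    @Measurable.prodMk Ω (configSigma N U {w}) _ _ _ _ _ _
      (measurable_offspring_configSigma (Set.mem_singleton w))
      (measurable_uniform_configSigma (Set.mem_singleton w))
  have hY : Measurable[configSigma N U {v | ∃ i, w ++ [i] <+: v}] fun ω i => (U (w ++ [i]) ω,
      HasAccessiblePath (fun v => N v ω) (fun v => U v ω) θ n (w ++ [i])) :=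
    @measurable_children Ω N U (configSigma N U _) θ n w
      (fun i v hv => measurable_offspring_configSigma ⟨i, hv⟩)
      fun i v hv => measurable_uniform_configSigma ⟨i, hv⟩
  rw [IndepFun_iff_Indep]
  exact indep_of_indep_of_le_left (indep_of_indep_of_le_right
    (indep_iSup_of_disjoint h.vertexSigma_le h.iIndep_vertexSigma (disjoint_singleton_subtrees w))
    hY.comap_le) hX.comap_le

/-- Condition on the offspring number and the uniform variable of `w`. -/
lemma measure_survivalEvent_succ [IsFiniteMeasure P] [SFinite ν] (h : IsBGWWithUniforms P ν N U)
    (θ : ℝ) (n : ℕ) (w : List ℕ) (b : ℝ) :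
    P (survivalEvent N U θ (n + 1) w b) = ∫⁻ u in Set.Ioo 0 1 ∩ Set.Ioi b,
      ∫⁻ k, P (⋃ i ∈ Finset.range k, survivalEvent N U θ n (w ++ [i]) (u - θ)) ∂ν := by
  let X : Ω → ℕ × ℝ := fun ω => (N w ω, U w ω)
  let Y : Ω → ℕ → ℝ × Prop := fun ω i => (U (w ++ [i]) ω,
    HasAccessiblePath (fun v => N v ω) (fun v => U v ω) θ n (w ++ [i]))
  have hX : Measurable X := (h.measurable_offspring w).prodMk (h.measurable_uniform w)
  have hY : Measurable Y := measurable_children θ n (fun _ v _ => h.measurable_offspring v)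
    fun _ v _ => h.measurable_uniform v
  let A : Set ((ℕ × ℝ) × (ℕ → ℝ × Prop)) :=
    {x | b < x.1.2 ∧ ∃ i < x.1.1, x.1.2 - θ < (x.2 i).1 ∧ (x.2 i).2}
  have hA : MeasurableSet A := by
    simp only [A, measurableSet_setOfPred]
    refine (measurableSet_setOfPred.1 (measurableSet_lt ?_ ?_)).and <| Measurable.exists fun i =>
      (measurableSet_setOfPred.1 (measurableSet_lt ?_ ?_)).and <|
        (measurableSet_setOfPred.1 (measurableSet_lt ?_ ?_)).and ?_
    all_goals fun_prop
  have hsection (u : ℝ) (k : ℕ) : P {ω | ((k, u), Y ω) ∈ A} = (Set.Ioi b).indicator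
      (fun u => P (⋃ i ∈ Finset.range k, survivalEvent N U θ n (w ++ [i]) (u - θ))) u := by
    by_cases hu : b < u
    · rw [Set.indicator_of_mem (Set.mem_Ioi.2 hu)]
      congr 1
      ext ω
      simp [A, Y, survivalEvent, hu, and_left_comm]
    · simp [A, hu]
  have hmeas : Measurable fun x => P {ω | (x, Y ω) ∈ A} :=
    measurable_measure_prodMk_left (ν := P) ((measurable_fst.prodMk (hY.comp measurable_snd)) hA)
  have hevent : survivalEvent N U θ (n + 1) w b = {ω | (X ω, Y ω) ∈ A} := by
    simp only [survivalEvent, HasAccessiblePath, rmfLabel_lt_rmfLabel_append_singleton_iff, A, X, Y,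
      Set.mem_ofPred_eq]
  rw [hevent, measure_preimage_prodMk_eq_lintegral hX hY (h.indepFun_children θ n w) hA,
    h.map_prodMk, lintegral_prod_symm _ hmeas.aemeasurable, Set.inter_comm,
    ← Measure.restrict_restrict measurableSet_Ioi, ← lintegral_indicator measurableSet_Ioi]
  refine lintegral_congr fun u => ?_
  simp only [hsection]
  by_cases hu : u ∈ Set.Ioi b
  · simp only [Set.indicator_of_mem hu]
  · simp only [Set.indicator_of_notMem hu, lintegral_zero]

lemma ofReal_integral_one_sub_pow_le_lintegral [IsFiniteMeasure ν]
    (h : IsBGWWithUniforms P ν N U) {z a : ℝ} (hz : z ∈ Set.Icc (0 : ℝ) 1)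
    (hle : ∀ i, z ≤ P.real (survivalEvent N U θ n (w ++ [i]) a)) :
    ENNReal.ofReal (∫ k : ℕ, (1 - (1 - z) ^ k) ∂ν)
      ≤ ∫⁻ k, P (⋃ i ∈ Finset.range k, survivalEvent N U θ n (w ++ [i]) a) ∂ν := by
  have := h.indep_offspring.isProbabilityMeasure
  have hpow (k : ℕ) : 0 ≤ (1 - z) ^ k ∧ (1 - z) ^ k ≤ 1 :=
    ⟨pow_nonneg (sub_nonneg.2 hz.2) k, pow_le_one₀ (sub_nonneg.2 hz.2) (sub_le_self _ hz.1)⟩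
  have hint : Integrable (fun k : ℕ => 1 - (1 - z) ^ k) ν :=
    .of_bound .of_discrete 1 <| .of_forall fun k => by
      rw [Real.norm_of_nonneg (sub_nonneg.2 (hpow k).2)]
      exact sub_le_self _ (hpow k).1
  rw [ofReal_integral_eq_lintegral_ofReal hint (.of_forall fun k => sub_nonneg.2 (hpow k).2)]
  refine lintegral_mono fun k => ENNReal.ofReal_le_of_le_toReal ?_
  exact one_sub_pow_le_measureReal_biUnion (fun i => h.measurableSet_survivalEvent θ n _ a)
    (h.iIndepSet_survivalEvent θ n w a) hle k

lemma measure_survivalEvent_zero (h : IsBGWWithUniforms P ν N U) (θ : ℝ) (w : List ℕ) (b : ℝ) :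
    P (survivalEvent N U θ 0 w b) = volume (Set.Ioo 0 1 ∩ Set.Ioi b) := by
  have hevent : survivalEvent N U θ 0 w b = U w ⁻¹' Set.Ioi b := by
    simp only [survivalEvent, HasAccessiblePath, and_true, Set.preimage, Set.mem_Ioi]
  rw [hevent, ← Measure.map_apply (h.measurable_uniform w) measurableSet_Ioi, h.law_uniform,
    Measure.restrict_apply measurableSet_Ioi, Set.inter_comm]

lemma lintegral_le_measure_survivalEvent [IsFiniteMeasure P] [IsFiniteMeasure ν]
    (h : IsBGWWithUniforms P ν N U) {c δ : ℝ} {f : ℝ → ℝ} (hf : IsSubeigenfunction θ c f)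
    (hθ : 0 ≤ θ) (hc : 0 < c) (hδ : δ ∈ Set.Icc (0 : ℝ) 1)
    (hgrow : ∀ z ∈ Set.Icc 0 δ, 1 / c * z ≤ ∫ k : ℕ, (1 - (1 - z) ^ k) ∂ν)
    (n : ℕ) (w : List ℕ) (b : ℝ) :
    ∫⁻ y in Set.Ioo 0 1 ∩ Set.Ioi b, ENNReal.ofReal (δ * f y)
      ≤ P (survivalEvent N U θ n w b) := by
  induction n generalizing w b with
  | zero =>
    rw [h.measure_survivalEvent_zero, ← setLIntegral_one]
    exact lintegral_mono fun y =>
      ENNReal.ofReal_le_one.2 (mul_le_one₀ hδ.2 (hf.nonneg y) (hf.le_one y))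
  | succ n ih =>
    rw [h.measure_survivalEvent_succ]
    refine setLIntegral_mono' (measurableSet_Ioo.inter measurableSet_Ioi) fun u hu => ?_
    have hu1 : u ≤ 1 := hu.1.2.le
    have hz : δ * meanOperator θ f u ∈ Set.Icc 0 δ :=
      ⟨mul_nonneg hδ.1 (meanOperator_nonneg hθ (fun y _ => hf.nonneg y) hu1),
        mul_le_of_le_one_right hδ.1 (meanOperator_le_one hθ hf.continuous hf.le_one hu1)⟩
    have hle (i : ℕ) :
        δ * meanOperator θ f u ≤ P.real (survivalEvent N U θ n (w ++ [i]) (u - θ)) := by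
      rw [measureReal_def, ← ENNReal.ofReal_le_iff_le_toReal (measure_ne_top P _),
        ← meanOperator_const_mul, ofReal_meanOperator_eq_lintegral hθ (hf.continuous.const_mul δ)
          (fun y => mul_nonneg hδ.1 (hf.nonneg y)) hu1]
      exact ih (w ++ [i]) (u - θ)
    refine le_trans (ENNReal.ofReal_le_ofReal ?_)
      (h.ofReal_integral_one_sub_pow_le_lintegral ⟨hz.1, hz.2.trans hδ.2⟩ hle)
    calc δ * f u = 1 / c * (δ * (c * f u)) := by field_simp
      _ ≤ 1 / c * (δ * meanOperator θ f u) := by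
        have := hf.mul_le_meanOperator u ⟨hu.1.1.le, hu1⟩
        have := hδ.1
        gcongr
      _ ≤ ∫ k : ℕ, (1 - (1 - δ * meanOperator θ f u) ^ k) ∂ν := hgrow _ hz

lemma le_measure_percolationEvent [IsFiniteMeasure P] (h : IsBGWWithUniforms P ν N U) {b : ℝ}
    {p : ENNReal} (hp : ∀ n, p ≤ P (survivalEvent N U θ n [] b)) :
    p ≤ P (percolationEvent N U θ) := by
  have hlim := tendsto_measure_iInter_atTop
    (fun n => (h.measurableSet_survivalEvent θ n [] b).nullMeasurableSet)
    (antitone_survivalEvent N U θ [] b) ⟨0, measure_ne_top P _⟩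
  refine (ge_of_tendsto' hlim hp).trans (measure_mono fun ω hω => ?_)
  exact accessibilityPercolation_of_forall_hasAccessiblePath fun n => (Set.mem_iInter.1 hω n).2

lemma percolationEvent_pos_of_isSubeigenfunction [IsFiniteMeasure P] [IsFiniteMeasure ν]
    (h : IsBGWWithUniforms P ν N U) (hθ : 0 ≤ θ) {c : ℝ} {f : ℝ → ℝ}
    (hf : IsSubeigenfunction θ c f) (hint : Integrable (fun k : ℕ => (k : ℝ)) ν)
    (hsuper : 1 < (∫ k : ℕ, (k : ℝ) ∂ν) * c) : 0 < P (percolationEvent N U θ) := by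
  have hc : 0 < c :=
    pos_of_mul_pos_right (zero_lt_one.trans hsuper) (integral_nonneg fun k => k.cast_nonneg)
  obtain ⟨δ, hδ, hgrow⟩ := exists_mul_le_integral_one_sub_pow hint ((div_lt_iff₀ hc).2 hsuper)
  have hmean : 0 < meanOperator θ f 0 :=
    (mul_pos hc hf.zero_pos).trans_le (hf.mul_le_meanOperator 0 ⟨le_rfl, zero_le_one⟩)
  refine (ENNReal.ofReal_pos.2 (mul_pos hδ.1 hmean)).trans_le
    (h.le_measure_percolationEvent (b := 0 - θ) fun n => ?_)
  rw [← meanOperator_const_mul, ofReal_meanOperator_eq_lintegral hθ (hf.continuous.const_mul δ)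
    (fun y => mul_nonneg hδ.1.le (hf.nonneg y)) zero_le_one]
  exact h.lintegral_le_measure_survivalEvent hf hθ hc ⟨hδ.1.le, hδ.2⟩ hgrow n [] (0 - θ)

end IsBGWWithUniforms

section SquareRootBound

lemma one_sub_sqrt_one_sub_inv_nonneg {m : ℝ} (hm : 1 ≤ m) : 0 ≤ 1 - √(1 - 1 / m) := by
  have : 0 ≤ 1 / m := by positivity
  rw [sub_nonneg, Real.sqrt_le_one]
  linarith

/-- The bound `1 - √(1 - 1 / m)` is the root in `[0, 1]` of `m * (θ * (2 - θ)) = 1`. -/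
lemma one_lt_mul_of_one_sub_sqrt_lt {m θ : ℝ} (hm : 1 ≤ m) (h1 : θ ≤ 1)
    (hθ : 1 - √(1 - 1 / m) < θ) : 1 < m * (θ * (2 - θ)) := by
  have hm0 : 0 < m := by linarith
  have hsq : (1 - θ) ^ 2 < 1 - 1 / m := (Real.lt_sqrt (sub_nonneg.2 h1)).1 (by linarith)
  rw [← div_lt_iff₀' hm0]
  linarith

lemma one_sub_sqrt_one_sub_inv_eq_mul {x : ℝ} (hx : 1 ≤ x) :
    1 - √(1 - 1 / x) = 2 / (1 + √(1 - 1 / x)) * (1 / (2 * x)) := by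
  have hx0 : 0 < x := by linarith
  have hsq : √(1 - 1 / x) ^ 2 = 1 - 1 / x :=
    Real.sq_sqrt (sub_nonneg.2 ((div_le_one hx0).2 hx))
  have hpos : 0 < 1 + √(1 - 1 / x) := by positivity
  calc 1 - √(1 - 1 / x) = (1 - √(1 - 1 / x) ^ 2) / (1 + √(1 - 1 / x)) := by
        rw [eq_div_iff hpos.ne']
        ring
    _ = 2 / (1 + √(1 - 1 / x)) * (1 / (2 * x)) := by
        rw [hsq]
        field_simp
        ring

lemma isEquivalent_one_sub_sqrt_one_sub_inv :
    (fun x : ℝ => 1 - √(1 - 1 / x)) ~[atTop] (fun x : ℝ => 1 / (2 * x)) := by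
  have hinv : Tendsto (fun x : ℝ => 1 - 1 / x) atTop (nhds 1) := by
    simpa using (tendsto_inv_atTop_zero (𝕜 := ℝ)).const_sub 1
  have hratio : Tendsto (fun x : ℝ => 2 / (1 + √(1 - 1 / x))) atTop (nhds 1) := by
    have hdenom := hinv.sqrt.const_add 1
    rw [Real.sqrt_one, one_add_one_eq_two] at hdenom
    have hquot : Tendsto (fun x : ℝ => 2 / (1 + √(1 - 1 / x))) atTop (nhds (2 / 2)) :=
      tendsto_const_nhds.div hdenom two_ne_zero
    rwa [div_self two_ne_zero] at hquot
  exact isEquivalent_iff_exists_eq_mul.2 ⟨_, hratio,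
    (eventually_ge_atTop 1).mono fun x hx => one_sub_sqrt_one_sub_inv_eq_mul hx⟩

end SquareRootBound

theorem proposition1p5_general
    {Ω : Type*} [MeasurableSpace Ω] (P : Measure Ω) [IsProbabilityMeasure P]
    (ν : Measure ℕ) [IsProbabilityMeasure ν]
    (N : List ℕ → Ω → ℕ) (U : List ℕ → Ω → ℝ) (hNU : IsBGWWithUniforms P ν N U)
    (m : ℝ) (hm : 1 ≤ m)
    (hmean : Integrable (fun k : ℕ => (k : ℝ)) ν ∧ ∫ k : ℕ, (k : ℝ) ∂ν = m) :
    (∀ θ : ℝ, 0 ≤ θ → θ ≤ 1 → 1 - √(1 - 1 / m) < θ → 0 < P (percolationEvent N U θ)) ∧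
    criticalTheta P N U ≤ 1 - √(1 - 1 / m) ∧
    (∀ t : ℝ, 0 < t → t ≤ 1 → IsCriticalMean t m → t ≤ 1 - √(1 - 1 / m)) ∧
    (fun x : ℝ => 1 - √(1 - 1 / x)) ~[atTop] (fun x : ℝ => 1 / (2 * x)) := by
  have hperc (θ : ℝ) (h0 : 0 ≤ θ) (h1 : θ ≤ 1) (hθ : 1 - √(1 - 1 / m) < θ) :
      0 < P (percolationEvent N U θ) :=
    hNU.percolationEvent_pos_of_isSubeigenfunction h0
      (isSubeigenfunction_ramp ((one_sub_sqrt_one_sub_inv_nonneg hm).trans_lt hθ) h1) hmean.1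
      (hmean.2.symm ▸ one_lt_mul_of_one_sub_sqrt_lt hm h1 hθ)
  refine ⟨hperc, ?_, fun t h0 h1 hcrit => ?_, isEquivalent_one_sub_sqrt_one_sub_inv⟩
  · refine Real.sSup_le (fun θ hθ => ?_) (one_sub_sqrt_one_sub_inv_nonneg hm)
    by_contra! hlt
    exact (hperc θ hθ.1 hθ.2.1 hlt).ne' hθ.2.2
  · by_contra! hlt
    exact (one_lt_mul_of_one_sub_sqrt_lt hm h1 hlt).not_ge (hcrit.mul_le_one h0 h1)

/-- With `θ_c(m)` understood in both of its senses: as the critical parameter of the percolation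
model, and as the solution `t ∈ (0,1]` of `m_c(t) = m`. -/
theorem proposition1p5
    {Ω : Type*} [MeasurableSpace Ω] (P : Measure Ω) [IsProbabilityMeasure P]
    (ν : Measure ℕ) [IsProbabilityMeasure ν]
    (N : List ℕ → Ω → ℕ) (U : List ℕ → Ω → ℝ) (hNU : IsBGWWithUniforms P ν N U)
    (m : ℝ) (hm : 1 ≤ m)
    (hmean : Integrable (fun k : ℕ => (k : ℝ)) ν ∧ ∫ k : ℕ, (k : ℝ) ∂ν = m)
    (hLlogL : Integrable (fun k : ℕ => (k : ℝ) * Real.posLog (k : ℝ)) ν) :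
    (∀ θ : ℝ, 0 ≤ θ → θ ≤ 1 → 1 - √(1 - 1 / m) < θ → 0 < P (percolationEvent N U θ)) ∧
    criticalTheta P N U ≤ 1 - √(1 - 1 / m) ∧
    (∀ t : ℝ, 0 < t → t ≤ 1 → IsCriticalMean t m → t ≤ 1 - √(1 - 1 / m)) ∧
    (fun x : ℝ => 1 - √(1 - 1 / x)) ~[atTop] (fun x : ℝ => 1 / (2 * x)) :=
  proposition1p5_general P ν N U hNU m hm hmean
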